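/- For a polynomial $P \in \mathbb{C}[x,y]$ with $P \neq 0$, let $$\mathrm{m}(P) = \frac{1}{(2\pi i)^2}\int_{|x|=|y|=1} \log|P(x,y)|\,\frac{dx}{x}\frac{dy}{y} = \frac{1}{(2\pi)^2}\int_0^{2\pi}\!\!\int_0^{2\pi} \log\bigl|P(e^{i\theta_1},e^{i\theta_2})\bigr|\,d\theta_1\,d\theta_2$$ denote its (logarithmic) Mahler measure. For real parameters $\alpha$, $\beta$ put $$Q_\alpha(x,y)=(x^2+x+1)y^2+\alpha x(x+1)y+x(x^2+x+1),$$ $$R_\beta(x,y)=(x^2+x+1)y^2+\bigl(x^4+\beta x^3+(2\beta-4)x^2+\beta x+1\bigr)y+x^2(x^2+x+1).$$ Then for every real $\alpha\geq 4$ the integrals defining $\mathrm{m}(Q_\alpha)$ and $\mathrm{m}(R_{\alpha+2})$ converge absolutely, and $$\mathrm{m}(Q_\alpha)=\mathrm{m}(R_{\alpha+2}).$$ -/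

import Mathlib

noncomputable section

/-- The (logarithmic) Mahler measure of a polynomial `P ∈ ℂ[x₁, …, xₙ]`: the mean value of
`log |P|` over the unit torus `|x₁| = ⋯ = |xₙ| = 1`, parametrized by `x_j = exp (i θ_j)`,
`0 ≤ θ_j ≤ 2π`. -/
def mahlerMeasureLog {n : ℕ} (P : MvPolynomial (Fin n) ℂ) : ℝ :=
  (2 * Real.pi) ^ (-(n : ℤ)) *
    ∫ θ in Set.Icc (0 : Fin n → ℝ) (fun _ => 2 * Real.pi),
      Real.log ‖MvPolynomial.eval (torusMap 0 1 θ) P‖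

/-- The integral defining the Mahler measure is absolutely convergent, i.e. `log |P|` is
integrable over the unit torus. -/
def MahlerIntegrable {n : ℕ} (P : MvPolynomial (Fin n) ℂ) : Prop :=
  TorusIntegrable (fun z => Real.log ‖MvPolynomial.eval z P‖) 0 1

/-- The Mahler measure is
`(2πi)⁻ⁿ ∮_{𝕋ⁿ} log |P(x₁, …, xₙ)| (dx₁ / x₁) ⋯ (dxₙ / xₙ)`. -/
theorem mahlerMeasureLog_eq_torusIntegral {n : ℕ} (P : MvPolynomial (Fin n) ℂ) :
    (mahlerMeasureLog P : ℂ) =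
      (2 * Real.pi * Complex.I) ^ (-(n : ℤ)) *
        torusIntegral (fun z => (Real.log ‖MvPolynomial.eval z P‖ : ℂ) * ∏ i, (z i)⁻¹) 0 1 := by
  have key : ∀ θ : Fin n → ℝ,
      (∏ i, ((1 : Fin n → ℝ) i : ℂ) * Complex.exp (θ i * Complex.I) * Complex.I : ℂ) •
        ((Real.log ‖MvPolynomial.eval (torusMap 0 1 θ) P‖ : ℂ) * ∏ i, (torusMap 0 1 θ i)⁻¹)
      = Complex.I ^ n * ((Real.log ‖MvPolynomial.eval (torusMap 0 1 θ) P‖ : ℝ) : ℂ) := by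
    intro θ
    have h : (∏ i, Complex.exp (θ i * Complex.I)) ≠ 0 :=
      Finset.prod_ne_zero_iff.2 fun i _ => Complex.exp_ne_zero _
    simp only [torusMap, Pi.one_apply, Pi.zero_apply, Complex.ofReal_one, one_mul, zero_add,
      Finset.prod_mul_distrib, Finset.prod_const, Finset.card_univ, Fintype.card_fin,
      Finset.prod_inv_distrib, smul_eq_mul]
    generalize (∏ i, Complex.exp (θ i * Complex.I)) = p at h
    field_simp
  have hI : (Complex.I ^ n : ℂ) ≠ 0 := pow_ne_zero _ Complex.I_ne_zero
  have hpi : (Real.pi : ℂ) ≠ 0 := Complex.ofReal_ne_zero.2 Real.pi_ne_zero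
  unfold torusIntegral mahlerMeasureLog
  simp_rw [key]
  rw [MeasureTheory.integral_const_mul, integral_complex_ofReal]
  push_cast
  simp only [zpow_neg, zpow_natCast]
  field_simp
  ring

/-- `Q_α(x, y) = (x² + x + 1) y² + α x (x + 1) y + x (x² + x + 1)`. -/
def polyQ (α : ℝ) : MvPolynomial (Fin 2) ℂ :=
  let x : MvPolynomial (Fin 2) ℂ := MvPolynomial.X 0
  let y : MvPolynomial (Fin 2) ℂ := MvPolynomial.X 1
  let a : MvPolynomial (Fin 2) ℂ := MvPolynomial.C (α : ℂ)
  (x ^ 2 + x + 1) * y ^ 2 + a * x * (x + 1) * y + x * (x ^ 2 + x + 1)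

/-- `R_β(x, y) =
(x² + x + 1) y² + (x⁴ + β x³ + (2β - 4) x² + β x + 1) y + x² (x² + x + 1)`. -/
def polyR (β : ℝ) : MvPolynomial (Fin 2) ℂ :=
  let x : MvPolynomial (Fin 2) ℂ := MvPolynomial.X 0
  let y : MvPolynomial (Fin 2) ℂ := MvPolynomial.X 1
  let b : MvPolynomial (Fin 2) ℂ := MvPolynomial.C (β : ℂ)
  (x ^ 2 + x + 1) * y ^ 2 + (x ^ 4 + b * x ^ 3 + (2 * b - 4) * x ^ 2 + b * x + 1) * y
    + x ^ 2 * (x ^ 2 + x + 1)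

end

/-!
On the torus put `z = |1 + x| ^ 2` and `φ = arg y`. Up to a factor of modulus one, both `Q_α` and
`R_{α + 2}` are of the form `2 A cos (φ - s) + B`, where `A = z - 1` and `B` is affine in `α`. By
Jensen's formula the mean of `log |P|` over `|y| = 1` is the logarithm of the largest modulus of a
root of `u ^ 2 - B u + A ^ 2`, and its derivative in `α` is a multiple of `1 / √(B ^ 2 - 4 A ^ 2)`.
Averaging over `x`, the derivatives of the two Mahler measures become complete elliptic integrals
over `0 < z < 4`, which a Möbius transformation of `z` carries into each other as soon as `4 ≤ α`.
Hence `m(Q_α) - m(R_{α + 2})` is constant for `4 ≤ α`, and the constant is `0` because both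
measures are `log α + o(1)` as `α → ∞`.
-/

open Real MeasureTheory Set Filter Topology

noncomputable section

/-- The largest modulus of a root `u` of `u ^ 2 - B * u + A ^ 2`. If `2 * |A| ≤ |B|` the roots are
real; otherwise they are conjugate of modulus `|A|`, and the square root below is `0`. -/
def maxRootNorm (A B : ℝ) : ℝ := max |A| ((|B| + √(B ^ 2 - 4 * A ^ 2)) / 2)

lemma maxRootNorm_of_abs_le {A B : ℝ} (h : |B| ≤ 2 * |A|) : maxRootNorm A B = |A| := by
  have hdisc : B ^ 2 - 4 * A ^ 2 ≤ 0 := by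
    rw [← sq_abs A, ← sq_abs B]; nlinarith [abs_nonneg B]
  rw [maxRootNorm, Real.sqrt_eq_zero_of_nonpos hdisc, max_eq_left (by linarith)]

lemma maxRootNorm_of_le_abs {A B : ℝ} (h : 2 * |A| ≤ |B|) :
    maxRootNorm A B = (|B| + √(B ^ 2 - 4 * A ^ 2)) / 2 :=
  max_eq_right (by linarith [Real.sqrt_nonneg (B ^ 2 - 4 * A ^ 2)])

lemma maxRootNorm_abs_right (A B : ℝ) : maxRootNorm A |B| = maxRootNorm A B := by
  rw [maxRootNorm, maxRootNorm, abs_abs, sq_abs]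

lemma continuous_maxRootNorm : Continuous fun p : ℝ × ℝ => maxRootNorm p.1 p.2 := by
  unfold maxRootNorm
  fun_prop

lemma maxRootNorm_zero_left (B : ℝ) : maxRootNorm 0 B = |B| := by
  simp [maxRootNorm, Real.sqrt_sq_eq_abs]

lemma maxRootNorm_div (A B : ℝ) {b : ℝ} (hb : 0 < b) :
    maxRootNorm (A / b) (B / b) = maxRootNorm A B / b := by
  have hsqrt : √((B / b) ^ 2 - 4 * (A / b) ^ 2) = √(B ^ 2 - 4 * A ^ 2) / b := by
    rw [div_pow, div_pow, ← mul_div_assoc, ← sub_div, Real.sqrt_div' _ (sq_nonneg b),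
      Real.sqrt_sq hb.le]
  rw [maxRootNorm, maxRootNorm, hsqrt, abs_div, abs_div, abs_of_pos hb, ← add_div,
    div_right_comm, max_div_div_right hb.le]

lemma maxRootNorm_le_max (A B : ℝ) : maxRootNorm A B ≤ max |A| |B| := by
  have hsqrt : √(B ^ 2 - 4 * A ^ 2) ≤ |B| :=
    Real.sqrt_le_iff.2 ⟨abs_nonneg B, by rw [sq_abs]; linarith [sq_nonneg A]⟩
  exact max_le_max_left _ (by linarith)

lemma max_div_two_le_maxRootNorm (A B : ℝ) : max |A| |B| / 2 ≤ maxRootNorm A B := by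
  rw [← max_div_div_right zero_le_two]
  exact max_le_max (by linarith [abs_nonneg A])
    (by linarith [Real.sqrt_nonneg (B ^ 2 - 4 * A ^ 2)])

lemma abs_log_maxRootNorm_sub_log_max_le (A B : ℝ) :
    |log (maxRootNorm A B) - log (max |A| |B|)| ≤ log 2 := by
  rcases (le_max_of_le_left (abs_nonneg A) : 0 ≤ max |A| |B|).eq_or_lt with h0 | hpos
  · have : maxRootNorm A B = 0 :=
      le_antisymm (h0 ▸ maxRootNorm_le_max A B) (le_max_of_le_left (abs_nonneg A))
    simp [this, ← h0, Real.log_nonneg one_le_two]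
  · have hlow := Real.log_le_log (by positivity) (max_div_two_le_maxRootNorm A B)
    rw [Real.log_div hpos.ne' two_ne_zero] at hlow
    have hup := Real.log_le_log ((half_pos hpos).trans_le (max_div_two_le_maxRootNorm A B))
      (maxRootNorm_le_max A B)
    exact abs_le.2 ⟨by linarith, by linarith [Real.log_nonneg one_le_two]⟩

lemma maxRootNorm_pos {A d : ℝ} (h : -(2 * |A|) < d) : 0 < maxRootNorm A d := by
  refine lt_of_lt_of_le ?_ (max_div_two_le_maxRootNorm A d)
  rcases eq_or_ne A 0 with rfl | hA
  · have : d ≠ 0 := by rintro rfl; simp at h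
    positivity
  · positivity

lemma maxRootNorm_mono_right {A d₁ d₂ : ℝ} (h : -(2 * |A|) ≤ d₁) (h12 : d₁ ≤ d₂) :
    maxRootNorm A d₁ ≤ maxRootNorm A d₂ := by
  rcases le_total 0 d₁ with h0 | h0
  · have : |d₁| ≤ |d₂| := abs_le_abs_of_nonneg h0 h12
    unfold maxRootNorm
    gcongr
  · rw [maxRootNorm_of_abs_le (by rw [abs_of_nonpos h0]; linarith)]
    exact le_max_left _ _

/-! ### The mean of `log |2 A cos φ + B|` -/

lemma exists_root_norm_eq_maxRootNorm (A B : ℝ) :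
    ∃ u : ℂ, u ^ 2 - B * u + (A : ℂ) ^ 2 = 0 ∧ ‖u‖ = maxRootNorm A B := by
  suffices h : ∃ u : ℂ, u ^ 2 - (|B| : ℝ) * u + (A : ℂ) ^ 2 = 0 ∧ ‖u‖ = maxRootNorm A |B| by
    obtain ⟨u, hu, hnorm⟩ := h
    rw [maxRootNorm_abs_right] at hnorm
    rcases abs_choice B with hB | hB
    · exact ⟨u, by rwa [hB] at hu, hnorm⟩
    · refine ⟨-u, ?_, by rwa [norm_neg]⟩
      rw [hB] at hu
      push_cast at hu
      linear_combination hu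
  rcases le_total (2 * |A|) |B| with h | h
  · have hdisc : 0 ≤ |B| ^ 2 - 4 * A ^ 2 := by
      rw [← sq_abs A]; nlinarith [abs_nonneg A]
    refine ⟨((|B| + √(|B| ^ 2 - 4 * A ^ 2)) / 2 : ℝ), ?_, ?_⟩
    · norm_cast
      linear_combination Real.sq_sqrt hdisc / 4
    · rw [Complex.norm_of_nonneg (by positivity), maxRootNorm_of_le_abs (by rwa [abs_abs]), abs_abs]
  · have hdisc : 0 ≤ 4 * A ^ 2 - |B| ^ 2 := by
      rw [← sq_abs A]; nlinarith [abs_nonneg B]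
    set s := √(4 * A ^ 2 - |B| ^ 2)
    have hs : s ^ 2 = 4 * A ^ 2 - |B| ^ 2 := Real.sq_sqrt hdisc
    refine ⟨⟨|B| / 2, s / 2⟩, ?_, ?_⟩
    · refine Complex.ext ?_ ?_
      · simp only [pow_two, Complex.add_re, Complex.sub_re, Complex.mul_re, Complex.ofReal_re,
          Complex.ofReal_im, zero_mul, sub_zero, mul_zero, Complex.zero_re]
        linear_combination (-1 / 4) * hs
      · simp only [pow_two, Complex.add_im, Complex.sub_im, Complex.mul_im, Complex.ofReal_re,
          Complex.ofReal_im, zero_mul, add_zero, mul_zero, Complex.zero_im]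
        ring
    · rw [maxRootNorm_of_abs_le (by rwa [abs_abs]), Complex.norm_eq_sqrt_sq_add_sq,
        show (|B| / 2) ^ 2 + (s / 2) ^ 2 = A ^ 2 by linear_combination hs / 4,
        Real.sqrt_sq_eq_abs]

open Polynomial in
lemma mahlerMeasure_C_mul_X_sq_add_C_mul_X_add_C (A B : ℝ) :
    (C (A : ℂ) * X ^ 2 + C (B : ℂ) * X + C (A : ℂ)).mahlerMeasure = maxRootNorm A B := by
  rcases eq_or_ne A 0 with rfl | hA
  · have hX : (X : ℂ[X]).mahlerMeasure = 1 := by simpa using mahlerMeasure_X_add_C 0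
    simp [maxRootNorm_zero_left, mahlerMeasure_mul, hX]
  obtain ⟨u, hu, hnorm⟩ := exists_root_norm_eq_maxRootNorm A B
  have hAu : |A| ≤ ‖u‖ := hnorm ▸ le_max_left _ _
  have hA' : (A : ℂ) ≠ 0 := Complex.ofReal_ne_zero.2 hA
  have hu0 : u ≠ 0 := norm_pos_iff.1 ((abs_pos.2 hA).trans_le hAu)
  have hfactor : C (A : ℂ) * X ^ 2 + C (B : ℂ) * X + C (A : ℂ) =
      (C (A : ℂ) * X + C u) * (X + C (A / u)) := by
    have hB : (B : ℂ) = u + A * (A / u) := by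
      field_simp
      linear_combination -hu
    have hprod : C u * C (A / u) = C (A : ℂ) := by rw [← C_mul, mul_div_cancel₀ _ hu0]
    rw [hB, C_add, C_mul, ← hprod]
    ring
  have hle : ‖(A : ℂ) / u‖ ≤ 1 := by
    rw [norm_div, Complex.norm_real]
    exact div_le_one_of_le₀ hAu (norm_nonneg u)
  rw [hfactor, mahlerMeasure_mul, mahlerMeasure_C_mul_X_add_C hA', mahlerMeasure_X_add_C,
    max_eq_left hle, mul_one, Complex.norm_real, Real.norm_eq_abs, max_eq_right hAu, hnorm]

open Polynomial in
lemma norm_eval_circleMap_reciprocal_quadratic (A B φ : ℝ) :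
    ‖(C (A : ℂ) * X ^ 2 + C (B : ℂ) * X + C (A : ℂ)).eval (circleMap 0 1 φ)‖ =
      |2 * A * cos φ + B| := by
  have : (C (A : ℂ) * X ^ 2 + C (B : ℂ) * X + C (A : ℂ)).eval (circleMap 0 1 φ) =
      Complex.exp (φ * Complex.I) * ((2 * A * cos φ + B : ℝ) : ℂ) := by
    simp only [circleMap, eval_add, eval_mul, eval_pow, eval_C, eval_X, Complex.ofReal_one,
      one_mul, zero_add]
    push_cast
    rw [Complex.cos, neg_mul, Complex.exp_neg]
    field_simp
    ring
  rw [this, norm_mul, Complex.norm_exp_ofReal_mul_I, one_mul, Complex.norm_real,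
    Real.norm_eq_abs]

theorem integral_log_abs_two_mul_cos_add (A B : ℝ) :
    ∫ φ in 0..2 * π, log |2 * A * cos φ + B| = 2 * π * log (maxRootNorm A B) := by
  rw [← mahlerMeasure_C_mul_X_sq_add_C_mul_X_add_C,
    ← Polynomial.logMahlerMeasure_eq_log_MahlerMeasure, Polynomial.logMahlerMeasure_def,
    circleAverage_def, smul_eq_mul, mul_inv_cancel_left₀ two_pi_pos.ne']
  simp only [norm_eval_circleMap_reciprocal_quadratic]

lemma integral_log_abs_two_mul_cos_sub_add (A B s : ℝ) :
    ∫ φ in 0..2 * π, log |2 * A * cos (φ - s) + B| = 2 * π * log (maxRootNorm A B) := by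
  have hper : Function.Periodic (fun φ => log |2 * A * cos φ + B|) (2 * π) := fun φ => by
    simp only [cos_add_two_pi]
  rw [intervalIntegral.integral_comp_sub_right (fun φ => log |2 * A * cos φ + B|),
    ← integral_log_abs_two_mul_cos_add, sub_eq_neg_add (2 * π), zero_sub,
    hper.intervalIntegral_add_eq (-s) 0, zero_add]

lemma intervalIntegrable_log_abs_two_mul_cos_sub_add (A B s a b : ℝ) :
    IntervalIntegrable (fun φ => log |2 * A * cos (φ - s) + B|) volume a b := by
  have hmero : MeromorphicOn (fun φ : ℝ => 2 * A * cos (φ - s) + B) (uIcc a b) := fun x _ =>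
    (by fun_prop : AnalyticAt ℝ (fun φ : ℝ => 2 * A * cos (φ - s) + B) x).meromorphicAt
  exact hmero.intervalIntegrable_log_norm

lemma ae_cos_ne (c : ℝ) : ∀ᵐ θ : ℝ, cos θ ≠ c := by
  by_cases hc : ∃ θ₀, cos θ₀ = c
  · obtain ⟨θ₀, rfl⟩ := hc
    have hcount : {θ | cos θ = cos θ₀}.Countable := by
      refine ((countable_range fun k : ℤ => 2 * k * π + θ₀).union
        (countable_range fun k : ℤ => 2 * k * π - θ₀)).mono fun θ hθ => ?_
      obtain ⟨k, hk | hk⟩ := Real.cos_eq_cos_iff.1 (Eq.symm hθ)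
      exacts [Or.inl ⟨k, hk.symm⟩, Or.inr ⟨k, hk.symm⟩]
    exact hcount.ae_notMem volume
  · exact ae_of_all _ fun θ hθ => hc ⟨θ, hθ⟩

/-! ### Dependence on the parameter -/

lemma lintegral_Ioo_eq_lintegral_deriv_mul_of_deriv_pos {f f' : ℝ → ℝ} {a b : ℝ} (hab : a ≤ b)
    (hf : ContinuousOn f (Icc a b)) (hff' : ∀ x ∈ Ioo a b, HasDerivAt f (f' x) x)
    (hf' : ∀ x ∈ Ioo a b, 0 < f' x) (g : ℝ → ENNReal) :
    ∫⁻ y in Ioo (f a) (f b), g y = ∫⁻ x in Ioo a b, ENNReal.ofReal (f' x) * g (f x) := by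
  have hmono : StrictMonoOn f (Icc a b) :=
    strictMonoOn_of_deriv_pos (convex_Icc a b) hf fun x hx => by
      rw [interior_Icc] at hx
      exact (hff' x hx).deriv ▸ hf' x hx
  rw [← hf.image_Ioo_of_strictMonoOn hab hmono]
  exact lintegral_image_eq_lintegral_deriv_mul_of_monotoneOn measurableSet_Ioo
    (fun x hx => (hff' x hx).hasDerivWithinAt) (hmono.monotoneOn.mono Ioo_subset_Icc_self) g

lemma lintegral_Ioc_deriv_of_deriv_pos {f f' : ℝ → ℝ} {a b : ℝ} (hab : a ≤ b)
    (hf : ContinuousOn f (Icc a b)) (hff' : ∀ x ∈ Ioo a b, HasDerivAt f (f' x) x)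
    (hf' : ∀ x ∈ Ioo a b, 0 < f' x) :
    ∫⁻ x in Ioc a b, ENNReal.ofReal (f' x) = ENNReal.ofReal (f b - f a) := by
  have := lintegral_Ioo_eq_lintegral_deriv_mul_of_deriv_pos hab hf hff' hf' 1
  simp only [Pi.one_apply, mul_one, lintegral_const, Measure.restrict_apply_univ, one_mul,
    Real.volume_Ioo] at this
  rw [this, setLIntegral_congr Ioo_ae_eq_Ioc]

lemma hasDerivAt_log_maxRootNorm {A x : ℝ} (hx : 2 * |A| < x) :
    HasDerivAt (fun x => log (maxRootNorm A x)) (1 / √(x ^ 2 - 4 * A ^ 2)) x := by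
  have hx0 : 0 < x := by linarith [abs_nonneg A]
  have hdisc : 0 < x ^ 2 - 4 * A ^ 2 := by
    rw [← sq_abs A]; nlinarith [abs_nonneg A]
  have := Real.sqrt_pos.2 hdisc
  have hEq : (fun x => maxRootNorm A x) =ᶠ[𝓝 x] fun x => (x + √(x ^ 2 - 4 * A ^ 2)) / 2 := by
    filter_upwards [lt_mem_nhds hx] with y hy
    have hy0 : 0 ≤ y := by linarith [abs_nonneg A]
    rw [maxRootNorm_of_le_abs (by rw [abs_of_nonneg hy0]; exact hy.le), abs_of_nonneg hy0]
  have hroot : HasDerivAt (fun x => (x + √(x ^ 2 - 4 * A ^ 2)) / 2)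
      ((1 + 2 * x / (2 * √(x ^ 2 - 4 * A ^ 2))) / 2) x := by
    have hsq : HasDerivAt (fun x : ℝ => x ^ 2 - 4 * A ^ 2) (2 * x) x := by
      simpa using (hasDerivAt_pow 2 x).sub_const (4 * A ^ 2)
    exact ((hasDerivAt_id' x).add (hsq.sqrt hdisc.ne')).div_const 2
  have hpos : 0 < maxRootNorm A x := maxRootNorm_pos (by linarith [abs_nonneg A])
  convert (hroot.congr_of_eventuallyEq hEq).log hpos.ne' using 1
  rw [hEq.eq_of_nhds]
  field_simp
  ring

lemma lintegral_one_div_sqrt_sq_sub_of_two_mul_abs_le {A d₁ d₂ : ℝ} (h₀ : 0 < d₁)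
    (h₁ : 2 * |A| ≤ d₁) (h₁₂ : d₁ ≤ d₂) :
    ∫⁻ x in Ioc d₁ d₂, ENNReal.ofReal (1 / √(x ^ 2 - 4 * A ^ 2)) =
      ENNReal.ofReal (log (maxRootNorm A d₂) - log (maxRootNorm A d₁)) := by
  refine lintegral_Ioc_deriv_of_deriv_pos (f := fun x => log (maxRootNorm A x)) h₁₂ ?_
    (fun x hx => hasDerivAt_log_maxRootNorm (h₁.trans_lt hx.1)) fun x hx => ?_
  · have hcont : Continuous fun x => maxRootNorm A x :=
      continuous_maxRootNorm.comp (by fun_prop : Continuous fun x => (A, x))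
    exact hcont.continuousOn.log fun x hx =>
      (maxRootNorm_pos (by linarith [abs_nonneg A, hx.1])).ne'
  · have : 0 < x ^ 2 - 4 * A ^ 2 := by
      rw [← sq_abs A]; nlinarith [abs_nonneg A, hx.1]
    positivity

lemma lintegral_one_div_sqrt_sq_sub_of_le_two_mul_abs {A d₁ d₂ : ℝ} (h₁ : -(2 * |A|) < d₁)
    (h₁₂ : d₁ ≤ d₂) (h₂ : d₂ ≤ 2 * |A|) :
    ∫⁻ x in Ioc d₁ d₂, ENNReal.ofReal (1 / √(x ^ 2 - 4 * A ^ 2)) =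
      ENNReal.ofReal (log (maxRootNorm A d₂) - log (maxRootNorm A d₁)) := by
  -- The radicand is not positive, so that the junk value `1 / √_ = 0` is the derivative of the
  -- constant `log (maxRootNorm A x) = log |A|`.
  rw [maxRootNorm_of_abs_le (abs_le.2 ⟨by linarith, h₂⟩),
    maxRootNorm_of_abs_le (abs_le.2 ⟨h₁.le, by linarith⟩), sub_self, ENNReal.ofReal_zero]
  refine setLIntegral_eq_zero measurableSet_Ioc fun x hx => ?_
  have hdisc : x ^ 2 - 4 * A ^ 2 ≤ 0 := by
    rw [← sq_abs A]; nlinarith [hx.1, hx.2]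
  simp [Real.sqrt_eq_zero_of_nonpos hdisc]

lemma lintegral_one_div_sqrt_sq_sub {A d₁ d₂ : ℝ} (h₁ : -(2 * |A|) < d₁) (h₁₂ : d₁ ≤ d₂) :
    ∫⁻ x in Ioc d₁ d₂, ENNReal.ofReal (1 / √(x ^ 2 - 4 * A ^ 2)) =
      ENNReal.ofReal (log (maxRootNorm A d₂) - log (maxRootNorm A d₁)) := by
  rcases le_total d₂ (2 * |A|) with hd₂ | hd₂
  · exact lintegral_one_div_sqrt_sq_sub_of_le_two_mul_abs h₁ h₁₂ hd₂
  rcases le_or_gt (2 * |A|) d₁ with hd₁ | hd₁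
  · exact lintegral_one_div_sqrt_sq_sub_of_two_mul_abs_le (by linarith) hd₁ h₁₂
  have hmono : ∀ {x y}, -(2 * |A|) < x → x ≤ y →
      0 ≤ log (maxRootNorm A y) - log (maxRootNorm A x) := fun hx hxy =>
    sub_nonneg.2 (Real.log_le_log (maxRootNorm_pos hx) (maxRootNorm_mono_right hx.le hxy))
  rw [← Ioc_union_Ioc_eq_Ioc hd₁.le hd₂,
    lintegral_union measurableSet_Ioc (Ioc_disjoint_Ioc_of_le le_rfl),
    lintegral_one_div_sqrt_sq_sub_of_le_two_mul_abs h₁ hd₁.le le_rfl,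
    lintegral_one_div_sqrt_sq_sub_of_two_mul_abs_le (by linarith) le_rfl hd₂,
    ← ENNReal.ofReal_add (hmono h₁ hd₁.le) (hmono (h₁.trans hd₁) hd₂), sub_add_sub_cancel']

lemma lintegral_div_sqrt_affine_sq_sub {A k e a b : ℝ} (hk : 0 < k) (hab : a ≤ b)
    (h : -(2 * |A|) < k * a + e) :
    ∫⁻ t in Ioc a b, ENNReal.ofReal (k / √((k * t + e) ^ 2 - 4 * A ^ 2)) =
      ENNReal.ofReal (log (maxRootNorm A (k * b + e)) - log (maxRootNorm A (k * a + e))) := by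
  rw [← lintegral_one_div_sqrt_sq_sub h (by gcongr), ← setLIntegral_congr Ioo_ae_eq_Ioc,
    ← setLIntegral_congr Ioo_ae_eq_Ioc,
    lintegral_Ioo_eq_lintegral_deriv_mul_of_deriv_pos (f := fun t => k * t + e) hab (by fun_prop)
      (fun t _ => by simpa using ((hasDerivAt_id t).const_mul k).add_const e) fun _ _ => hk]
  simp only [← ENNReal.ofReal_mul hk.le, mul_one_div]

lemma integrable_prod_of_le {X Y : Type*} [MeasurableSpace X] [MeasurableSpace Y] {μ : Measure X}
    {ν : Measure Y} [SFinite μ] [SFinite ν] {f g : X × Y → ℝ}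
    (hf : AEStronglyMeasurable f (μ.prod ν)) (hg : Integrable g (μ.prod ν)) (hfg : f ≤ g)
    (hslice : ∀ᵐ x ∂μ, Integrable (fun y => f (x, y)) ν)
    (hint : Integrable (fun x => ∫ y, f (x, y) ∂ν) μ) : Integrable f (μ.prod ν) := by
  suffices h : Integrable (g - f) (μ.prod ν) by simpa using hg.sub h
  rw [integrable_prod_iff (hg.aestronglyMeasurable.sub hf)]
  have hslice' := hg.prod_right_ae
  refine ⟨?_, (hg.integral_prod_left.sub hint).congr ?_⟩
  · filter_upwards [hslice, hslice'] with x hfx hgx using hgx.sub hfx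
  · filter_upwards [hslice, hslice'] with x hfx hgx
    rw [Pi.sub_apply, ← integral_sub hgx hfx]
    exact integral_congr_ae (ae_of_all _ fun y =>
      (Real.norm_of_nonneg (sub_nonneg.2 (hfg (x, y)))).symm)

lemma abs_log_maxRootNorm_le {A B c : ℝ} (hc : 0 < c) (h : c ≤ max |A| |B|) :
    |log (maxRootNorm A B)| ≤ log 2 + |log c| + |A| + |B| := by
  have hlow : log c ≤ log (max |A| |B|) := Real.log_le_log hc h
  have hup : log (max |A| |B|) ≤ |A| + |B| :=
    (Real.log_le_self (hc.le.trans h)).trans (max_le_add_of_nonneg (abs_nonneg A) (abs_nonneg B))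
  have hcomp := abs_le.1 (abs_log_maxRootNorm_sub_log_max_le A B)
  have := abs_nonneg (log c)
  have := neg_abs_le (log c)
  have := abs_nonneg A
  have := abs_nonneg B
  exact abs_le.2 ⟨by linarith, by linarith⟩

lemma log_maxRootNorm_sub_log {A B b : ℝ} (hb : 0 < b) (hpos : 0 < max |A| |B|) :
    log (maxRootNorm A B) - log b = log (maxRootNorm (A / b) (B / b)) := by
  have hne : maxRootNorm A B ≠ 0 :=
    ((half_pos hpos).trans_le (max_div_two_le_maxRootNorm A B)).ne'
  rw [maxRootNorm_div A B hb, Real.log_div hne hb.ne']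

lemma tendsto_log_maxRootNorm_affine_sub_log {A k e : ℝ} (hk : 0 < k) :
    Tendsto (fun b => log (maxRootNorm A (k * b + e)) - log b) atTop (𝓝 (log k)) := by
  have hA : Tendsto (fun b : ℝ => A / b) atTop (𝓝 0) := tendsto_const_nhds.div_atTop tendsto_id
  have hB : Tendsto (fun b => (k * b + e) / b) atTop (𝓝 k) := by
    have he : Tendsto (fun b : ℝ => k + e / b) atTop (𝓝 (k + 0)) :=
      tendsto_const_nhds.add (tendsto_const_nhds.div_atTop tendsto_id)
    rw [add_zero] at he
    refine he.congr' ?_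
    filter_upwards [eventually_ne_atTop 0] with b hb
    field_simp
  have hlim := (continuous_maxRootNorm.tendsto (0, k)).comp (hA.prodMk_nhds hB)
  rw [maxRootNorm_zero_left, abs_of_pos hk] at hlim
  refine (hlim.log hk.ne').congr' ?_
  have hB' : Tendsto (fun b => k * b + e) atTop atTop :=
    (tendsto_id.const_mul_atTop hk).atTop_add tendsto_const_nhds
  filter_upwards [eventually_gt_atTop 0, hB'.eventually_gt_atTop 0] with b hb hBb
  exact (log_maxRootNorm_sub_log hb (lt_max_of_lt_right (abs_pos.2 hBb.ne'))).symm

lemma abs_log_maxRootNorm_affine_sub_log_le {A k e m b : ℝ} (hb : 1 ≤ b) (hm : 0 < m)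
    (h : b * m ≤ max |A| |k * b + e|) :
    |log (maxRootNorm A (k * b + e)) - log b| ≤ log 2 + |log m| + |A| + |k| + |e| := by
  have hb0 : 0 < b := zero_lt_one.trans_le hb
  have hdiv : m ≤ max |A / b| |(k * b + e) / b| := by
    rwa [abs_div, abs_div, abs_of_pos hb0, max_div_div_right hb0.le, le_div_iff₀' hb0]
  have hA : |A / b| ≤ |A| := by
    rw [abs_div, abs_of_pos hb0]
    exact div_le_self (abs_nonneg A) hb
  have he : |e / b| ≤ |e| := by
    rw [abs_div, abs_of_pos hb0]
    exact div_le_self (abs_nonneg e) hb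
  have hke : |(k * b + e) / b| ≤ |k| + |e / b| := by
    rw [add_div, mul_div_cancel_right₀ k hb0.ne']
    exact abs_add_le k (e / b)
  rw [log_maxRootNorm_sub_log hb0 ((by positivity : 0 < b * m).trans_le h)]
  linarith [abs_log_maxRootNorm_le hm hdiv]

section AffineFamily

variable {X : Type*} [MeasurableSpace X] {μ : Measure X} {A B k e : X → ℝ}

lemma aestronglyMeasurable_log_maxRootNorm (hA : AEStronglyMeasurable A μ)
    (hB : AEStronglyMeasurable B μ) :
    AEStronglyMeasurable (fun x => log (maxRootNorm (A x) (B x))) μ :=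
  (Real.measurable_log.comp_aemeasurable (continuous_maxRootNorm.measurable.comp_aemeasurable
    (hA.aemeasurable.prodMk hB.aemeasurable))).aestronglyMeasurable

lemma integrable_log_maxRootNorm [IsFiniteMeasure μ] (hA : Integrable A μ) (hB : Integrable B μ)
    (hA0 : ∀ᵐ x ∂μ, A x ≠ 0) (hlog : Integrable (fun x => log (A x)) μ) :
    Integrable (fun x => log (maxRootNorm (A x) (B x))) μ := by
  have hdom := (((integrable_const (log 2)).add hlog.abs).add hA.abs).add hB.abs
  refine hdom.mono' (aestronglyMeasurable_log_maxRootNorm hA.1 hB.1) ?_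
  filter_upwards [hA0] with x hx
  simpa only [Real.log_abs, Real.norm_eq_abs, Pi.add_apply] using
    abs_log_maxRootNorm_le (abs_pos.2 hx) (le_max_left _ |B x|)

lemma integral_log_maxRootNorm_affine_sub [SFinite μ] {a b : ℝ} (hab : a ≤ b)
    (hA : Measurable A) (hk : Measurable k) (he : Measurable e)
    (hpos : ∀ᵐ x ∂μ, 0 < k x ∧ -(2 * |A x|) < k x * a + e x)
    (ha : Integrable (fun x => log (maxRootNorm (A x) (k x * a + e x))) μ)
    (hb : Integrable (fun x => log (maxRootNorm (A x) (k x * b + e x))) μ) :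
    (∫ x, log (maxRootNorm (A x) (k x * b + e x)) ∂μ) -
        ∫ x, log (maxRootNorm (A x) (k x * a + e x)) ∂μ =
      (∫⁻ t in Ioc a b, ∫⁻ x,
        ENNReal.ofReal (k x / √((k x * t + e x) ^ 2 - 4 * A x ^ 2)) ∂μ).toReal := by
  have hmono : ∀ᵐ x ∂μ, 0 ≤ log (maxRootNorm (A x) (k x * b + e x)) -
      log (maxRootNorm (A x) (k x * a + e x)) := by
    filter_upwards [hpos] with x hx
    have hle : k x * a + e x ≤ k x * b + e x := by
      have := hx.1
      gcongr
    exact sub_nonneg.2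
      (Real.log_le_log (maxRootNorm_pos hx.2) (maxRootNorm_mono_right hx.2.le hle))
  rw [← integral_sub hb ha, integral_eq_lintegral_of_nonneg_ae hmono (hb.sub ha).1,
    lintegral_lintegral_swap (by unfold Function.uncurry; fun_prop)]
  congr 1
  refine lintegral_congr_ae ?_
  filter_upwards [hpos] with x hx
  exact (lintegral_div_sqrt_affine_sq_sub hx.1 hab hx.2).symm

lemma tendsto_integral_log_maxRootNorm_sub_log [IsFiniteMeasure μ] {m : X → ℝ}
    (hA : Integrable A μ) (hk : Integrable k μ) (he : Integrable e μ)
    (hpos : ∀ᵐ x ∂μ, 0 < k x ∧ 0 < m x) (hlog : Integrable (fun x => log (m x)) μ)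
    (hm : ∀ᶠ b in atTop, ∀ᵐ x ∂μ, b * m x ≤ max |A x| |k x * b + e x|) :
    Tendsto (fun b => ∫ x, (log (maxRootNorm (A x) (k x * b + e x)) - log b) ∂μ) atTop
      (𝓝 (∫ x, log (k x) ∂μ)) := by
  have hdom := ((((integrable_const (log 2)).add hlog.abs).add hA.abs).add hk.abs).add he.abs
  refine tendsto_integral_filter_of_dominated_convergence _ ?_ ?_ hdom ?_
  · exact Eventually.of_forall fun b => (aestronglyMeasurable_log_maxRootNorm hA.1
      ((hk.1.mul_const b).add he.1)).sub aestronglyMeasurable_const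
  · filter_upwards [hm, eventually_ge_atTop 1] with b hmb hb
    filter_upwards [hmb, hpos] with x hx hpos
    exact abs_log_maxRootNorm_affine_sub_log_le hb hpos.2 hx
  · filter_upwards [hpos] with x hx
    exact tendsto_log_maxRootNorm_affine_sub_log hx.1

end AffineFamily

/-! ### Elliptic integrals -/

lemma lintegral_Ioc_comp_two_add_two_mul_cos (f : ℝ → ENNReal) :
    ∫⁻ θ in Ioc 0 (2 * π), f (2 + 2 * cos θ) = 2 * ∫⁻ θ in Ioo π (2 * π), f (2 + 2 * cos θ) := by
  have hreflect : ∫⁻ θ in Ioo 0 π, f (2 + 2 * cos θ) =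
      ∫⁻ θ in Ioo π (2 * π), f (2 + 2 * cos θ) := by
    have h := (volume.measurePreserving_sub_left (2 * π)).setLIntegral_comp_preimage_emb
      (measurableEmbedding_subLeft (2 * π)) (fun θ => f (2 + 2 * cos θ)) (Ioo π (2 * π))
    rw [preimage_const_sub_Ioo, sub_self, show 2 * π - π = π by ring] at h
    simpa only [cos_two_pi_sub] using h
  rw [← Ioc_union_Ioc_eq_Ioc pi_pos.le (by linarith [pi_pos] : π ≤ 2 * π),
    lintegral_union measurableSet_Ioc (Ioc_disjoint_Ioc_of_le le_rfl),
    ← setLIntegral_congr Ioo_ae_eq_Ioc, ← setLIntegral_congr Ioo_ae_eq_Ioc, hreflect,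
    ← two_mul (∫⁻ θ in Ioo π (2 * π), f (2 + 2 * cos θ))]

lemma lintegral_comp_two_add_two_mul_cos (f : ℝ → ENNReal) :
    ∫⁻ θ in Ioc 0 (2 * π), f (2 + 2 * cos θ) =
      ∫⁻ z in Ioo (0 : ℝ) 4, ENNReal.ofReal (2 / √(z * (4 - z))) * f z := by
  have hsin : ∀ θ ∈ Ioo π (2 * π), 0 < -2 * sin θ := fun θ hθ => by
    have := Real.sin_neg_of_neg_of_neg_pi_lt (x := θ - 2 * π) (by linarith [hθ.2])
      (by linarith [hθ.1])
    rw [sin_sub_two_pi] at this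
    linarith
  have hsubst := lintegral_Ioo_eq_lintegral_deriv_mul_of_deriv_pos
    (f := fun θ => 2 + 2 * cos θ) (f' := fun θ => -2 * sin θ) (by linarith [pi_pos] : π ≤ 2 * π)
    (by fun_prop)
    (fun θ _ => by simpa using ((Real.hasDerivAt_cos θ).const_mul 2).const_add 2) hsin
    (fun z => ENNReal.ofReal (2 / √(z * (4 - z))) * f z)
  have hweight : ∀ θ ∈ Ioo π (2 * π), ENNReal.ofReal (-2 * sin θ) *
      ENNReal.ofReal (2 / √((2 + 2 * cos θ) * (4 - (2 + 2 * cos θ)))) = 2 := fun θ hθ => by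
    have hs := hsin θ hθ
    rw [show (2 + 2 * cos θ) * (4 - (2 + 2 * cos θ)) = (-2 * sin θ) ^ 2 by
        linear_combination -4 * sin_sq_add_cos_sq θ, Real.sqrt_sq hs.le,
      ← ENNReal.ofReal_mul hs.le, mul_div_cancel₀ _ hs.ne', ENNReal.ofReal_ofNat]
  have h0 : 2 + 2 * cos π = 0 := by rw [cos_pi]; norm_num
  have h4 : 2 + 2 * cos (2 * π) = 4 := by rw [cos_two_pi]; norm_num
  rw [h0, h4] at hsubst
  rw [hsubst, lintegral_Ioc_comp_two_add_two_mul_cos, ← lintegral_const_mul' _ _ (by simp)]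
  refine setLIntegral_congr_fun measurableSet_Ioo fun θ hθ => ?_
  rw [← mul_assoc, hweight θ hθ]

lemma two_div_sqrt_mul_sqrt_div {z p : ℝ} (hz : z ∈ Ioo (0 : ℝ) 4) :
    2 / √(z * (4 - z)) * (√z / √p) = 2 / √((4 - z) * p) := by
  have hz4 : 0 ≤ 4 - z := sub_nonneg.2 hz.2.le
  have hsqrt : 0 < √z := Real.sqrt_pos.2 hz.1
  rw [Real.sqrt_mul hz.1.le, Real.sqrt_mul hz4, div_mul_div_comm, mul_assoc, mul_comm 2,
    mul_div_mul_left _ _ hsqrt.ne']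

lemma lintegral_sqrt_div_sqrt_comp_two_add_two_mul_cos (p : ℝ → ℝ) :
    ∫⁻ θ in Ioc 0 (2 * π), ENNReal.ofReal (√(2 + 2 * cos θ) / √(p (2 + 2 * cos θ))) =
      ∫⁻ z in Ioo (0 : ℝ) 4, ENNReal.ofReal (2 / √((4 - z) * p z)) := by
  rw [lintegral_comp_two_add_two_mul_cos fun z => ENNReal.ofReal (√z / √(p z))]
  refine setLIntegral_congr_fun measurableSet_Ioo fun z hz => ?_
  rw [← ENNReal.ofReal_mul (by positivity), two_div_sqrt_mul_sqrt_div hz]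

/-- The Möbius transformation matching the elliptic integrals of the two families: it maps `0`, `4`
to `4 / (1 + α)`, `4`. -/
def moebius (α w : ℝ) : ℝ := ((α - 4) * w + 4) / (1 + α - w)

lemma hasDerivAt_moebius {α w : ℝ} (hw : 1 + α - w ≠ 0) :
    HasDerivAt (moebius α) (α * (α - 3) / (1 + α - w) ^ 2) w := by
  have hnum : HasDerivAt (fun w : ℝ => (α - 4) * w + 4) (α - 4) w := by
    simpa using ((hasDerivAt_id w).const_mul (α - 4)).add_const 4
  have hden : HasDerivAt (fun w : ℝ => 1 + α - w) (-1) w := by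
    simpa using (hasDerivAt_id w).const_sub (1 + α)
  exact (hnum.div hden hw).congr_deriv (by congr 1; ring)

lemma quartic_moebius {α w : ℝ} (hw : 1 + α - w ≠ 0) :
    (4 - moebius α w) * ((moebius α w + α - 4) * (moebius α w ^ 2 + α * moebius α w - 4)) =
      (α * (α - 3) / (1 + α - w) ^ 2) ^ 2 * ((4 - w) * (α ^ 2 * w - 4 * (w - 1) ^ 2)) := by
  unfold moebius
  field_simp
  ring

lemma lintegral_quartic_eq_lintegral_Ioo_four_div {α : ℝ} (hα : 4 ≤ α) :
    ∫⁻ z in Ioo (0 : ℝ) 4,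
        ENNReal.ofReal (2 / √((4 - z) * ((z + α - 4) * (z ^ 2 + α * z - 4)))) =
      ∫⁻ z in Ioo (4 / (1 + α)) 4,
        ENNReal.ofReal (2 / √((4 - z) * ((z + α - 4) * (z ^ 2 + α * z - 4)))) := by
  have hc : 0 < 4 / (1 + α) := by positivity
  have hc1 : 4 / (1 + α) < 1 := (div_lt_one (by linarith)).2 (by linarith)
  have hzero : ∀ z ∈ Ioc 0 (4 / (1 + α)),
      ENNReal.ofReal (2 / √((4 - z) * ((z + α - 4) * (z ^ 2 + α * z - 4)))) = 0 := fun z hz => by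
    -- The radicand is not positive, so that the integrand takes the junk value `2 / √_ = 0`.
    have hz1 : z * (1 + α) ≤ 4 := (le_div_iff₀ (by linarith)).1 hz.2
    have hquad : z ^ 2 + α * z - 4 ≤ 0 := by nlinarith [hz.1, hz.2]
    have hrad : (4 - z) * ((z + α - 4) * (z ^ 2 + α * z - 4)) ≤ 0 :=
      mul_nonpos_of_nonneg_of_nonpos (by linarith [hz.2])
        (mul_nonpos_of_nonneg_of_nonpos (by linarith [hz.1]) hquad)
    simp [Real.sqrt_eq_zero_of_nonpos hrad]
  rw [← Ioc_union_Ioo_eq_Ioo hc.le (hc1.trans (by norm_num)), lintegral_union measurableSet_Ioo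
    (disjoint_left.2 fun z hz hz' => hz.2.not_gt hz'.1), setLIntegral_eq_zero measurableSet_Ioc
    hzero, zero_add]

lemma lintegral_elliptic_eq {α : ℝ} (hα : 4 ≤ α) :
    ∫⁻ w in Ioo (0 : ℝ) 4, ENNReal.ofReal (2 / √((4 - w) * (α ^ 2 * w - 4 * (w - 1) ^ 2))) =
      ∫⁻ z in Ioo (0 : ℝ) 4,
        ENNReal.ofReal (2 / √((4 - z) * ((z + α - 4) * (z ^ 2 + α * z - 4)))) := by
  have hden : ∀ w ∈ Icc (0 : ℝ) 4, 0 < 1 + α - w := fun w hw => by linarith [hw.2]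
  have hderiv : ∀ w ∈ Icc (0 : ℝ) 4, 0 < α * (α - 3) / (1 + α - w) ^ 2 := fun w hw =>
    div_pos (mul_pos (by linarith) (by linarith)) (pow_pos (hden w hw) 2)
  have h0 : moebius α 0 = 4 / (1 + α) := by simp [moebius]
  have h4 : moebius α 4 = 4 := by
    have := (hden 4 (right_mem_Icc.2 zero_le_four)).ne'
    rw [moebius, div_eq_iff this]
    ring
  rw [lintegral_quartic_eq_lintegral_Ioo_four_div hα, ← h0]
  nth_rewrite 4 [← h4]
  rw [lintegral_Ioo_eq_lintegral_deriv_mul_of_deriv_pos zero_le_four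
    (fun w hw => (hasDerivAt_moebius (hden w hw).ne').continuousAt.continuousWithinAt)
    (fun w hw => hasDerivAt_moebius (hden w (Ioo_subset_Icc_self hw)).ne')
    (fun w hw => hderiv w (Ioo_subset_Icc_self hw))]
  refine setLIntegral_congr_fun measurableSet_Ioo fun w hw => ?_
  have hw' := Ioo_subset_Icc_self hw
  have hJ := hderiv w hw'
  rw [quartic_moebius (hden w hw').ne', Real.sqrt_mul (sq_nonneg _), Real.sqrt_sq hJ.le,
    ← ENNReal.ofReal_mul hJ.le, ← mul_div_assoc, mul_div_mul_left _ _ hJ.ne']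

/-! ### The two families -/

/-- The mean of `log |Q_α(x, y)|` over `|y| = 1`, as a function of `z = |1 + x| ^ 2`. -/
def logMeanQ (α z : ℝ) : ℝ := log (maxRootNorm (z - 1) (√z * α))

/-- The mean of `log |R_{α + 2}(x, y)|` over `|y| = 1`, as a function of `z = |1 + x| ^ 2`. -/
def logMeanR (α z : ℝ) : ℝ := log (maxRootNorm (z - 1) (z * α + (z ^ 2 - 2 * z - 2)))

lemma ae_two_add_two_mul_cos_pos (s : Set ℝ) :
    ∀ᵐ θ ∂volume.restrict s, 0 < 2 + 2 * cos θ := by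
  filter_upwards [ae_restrict_of_ae (ae_cos_ne (-1))] with θ hθ
  linarith [(neg_one_le_cos θ).lt_of_ne' hθ]

lemma integrableOn_log_two_mul_cos_add (B : ℝ) :
    IntegrableOn (fun θ => log (2 * cos θ + B)) (Ioc 0 (2 * π)) := by
  have := intervalIntegrable_log_abs_two_mul_cos_sub_add 1 B 0 0 (2 * π)
  rw [intervalIntegrable_iff_integrableOn_Ioc_of_le two_pi_pos.le] at this
  simpa only [mul_one, sub_zero, Real.log_abs] using this

lemma integrableOn_log_two_add_two_mul_cos :
    IntegrableOn (fun θ => log (2 + 2 * cos θ)) (Ioc 0 (2 * π)) := by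
  simpa only [add_comm] using integrableOn_log_two_mul_cos_add 2

lemma integral_log_two_add_two_mul_cos : ∫ θ in Ioc 0 (2 * π), log (2 + 2 * cos θ) = 0 := by
  have h := integral_log_abs_two_mul_cos_add 1 2
  rw [maxRootNorm_of_abs_le (by norm_num), abs_one, Real.log_one, mul_zero,
    intervalIntegral.integral_of_le two_pi_pos.le] at h
  simpa only [mul_one, Real.log_abs, add_comm] using h

lemma integrableOn_log_maxRootNorm {B : ℝ → ℝ} (hB : Continuous B) :
    IntegrableOn (fun θ => log (maxRootNorm (2 + 2 * cos θ - 1) (B θ))) (Ioc 0 (2 * π)) := by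
  refine integrable_log_maxRootNorm (Continuous.integrableOn_Ioc (by fun_prop))
    hB.integrableOn_Ioc ?_ ?_
  · filter_upwards [ae_restrict_of_ae (ae_cos_ne (-1 / 2))] with θ hθ h
    exact hθ (by linarith)
  · refine (integrableOn_log_two_mul_cos_add 1).congr_fun (fun θ _ => ?_) measurableSet_Ioc
    rw [show 2 + 2 * cos θ - 1 = 2 * cos θ + 1 by ring]

lemma integrableOn_logMeanQ (α : ℝ) :
    IntegrableOn (fun θ => logMeanQ α (2 + 2 * cos θ)) (Ioc 0 (2 * π)) :=
  integrableOn_log_maxRootNorm (by fun_prop)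

lemma integrableOn_logMeanR (α : ℝ) :
    IntegrableOn (fun θ => logMeanR α (2 + 2 * cos θ)) (Ioc 0 (2 * π)) :=
  integrableOn_log_maxRootNorm (by fun_prop)

lemma integral_logMeanQ_sub {a b : ℝ} (ha : 0 < a) (hab : a ≤ b) :
    (∫ θ in Ioc 0 (2 * π), logMeanQ b (2 + 2 * cos θ)) -
        ∫ θ in Ioc 0 (2 * π), logMeanQ a (2 + 2 * cos θ) =
      (∫⁻ t in Ioc a b, ∫⁻ w in Ioo (0 : ℝ) 4,
        ENNReal.ofReal (2 / √((4 - w) * (t ^ 2 * w - 4 * (w - 1) ^ 2)))).toReal := by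
  have hpos : ∀ᵐ θ ∂volume.restrict (Ioc 0 (2 * π)), 0 < √(2 + 2 * cos θ) ∧
      -(2 * |2 + 2 * cos θ - 1|) < √(2 + 2 * cos θ) * a + 0 := by
    filter_upwards [ae_two_add_two_mul_cos_pos _] with θ hθ
    have hsqrt := Real.sqrt_pos.2 hθ
    exact ⟨hsqrt, by linarith [mul_pos hsqrt ha, abs_nonneg (2 + 2 * cos θ - 1)]⟩
  have h := integral_log_maxRootNorm_affine_sub (e := fun _ => 0) hab (by fun_prop) (by fun_prop)
    (by fun_prop) hpos (integrableOn_log_maxRootNorm (by fun_prop))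
    (integrableOn_log_maxRootNorm (by fun_prop))
  simp only [add_zero] at h
  refine h.trans (congrArg ENNReal.toReal (lintegral_congr fun t => ?_))
  rw [← lintegral_sqrt_div_sqrt_comp_two_add_two_mul_cos fun w => t ^ 2 * w - 4 * (w - 1) ^ 2]
  refine lintegral_congr fun θ => ?_
  rw [mul_pow, Real.sq_sqrt (by linarith [neg_one_le_cos θ]), mul_comm (2 + 2 * cos θ)]

lemma integral_logMeanR_sub {a b : ℝ} (ha : 4 ≤ a) (hab : a ≤ b) :
    (∫ θ in Ioc 0 (2 * π), logMeanR b (2 + 2 * cos θ)) -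
        ∫ θ in Ioc 0 (2 * π), logMeanR a (2 + 2 * cos θ) =
      (∫⁻ t in Ioc a b, ∫⁻ z in Ioo (0 : ℝ) 4,
        ENNReal.ofReal (2 / √((4 - z) * ((z + t - 4) * (z ^ 2 + t * z - 4))))).toReal := by
  have hpos : ∀ᵐ θ ∂volume.restrict (Ioc 0 (2 * π)), 0 < 2 + 2 * cos θ ∧
      -(2 * |2 + 2 * cos θ - 1|) <
        (2 + 2 * cos θ) * a + ((2 + 2 * cos θ) ^ 2 - 2 * (2 + 2 * cos θ) - 2) := by
    filter_upwards [ae_two_add_two_mul_cos_pos _] with θ hθ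
    refine ⟨hθ, ?_⟩
    generalize 2 + 2 * cos θ = z at hθ ⊢
    nlinarith [neg_abs_le (z - 1)]
  refine (integral_log_maxRootNorm_affine_sub hab (by fun_prop) (by fun_prop) (by fun_prop) hpos
    (integrableOn_logMeanR a) (integrableOn_logMeanR b)).trans
    (congrArg ENNReal.toReal (lintegral_congr fun t => ?_))
  rw [← lintegral_sqrt_div_sqrt_comp_two_add_two_mul_cos fun z =>
    (z + t - 4) * (z ^ 2 + t * z - 4)]
  refine lintegral_congr fun θ => ?_
  have hz : 0 ≤ 2 + 2 * cos θ := by linarith [neg_one_le_cos θ]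
  generalize 2 + 2 * cos θ = z at hz ⊢
  rw [show (z * t + (z ^ 2 - 2 * z - 2)) ^ 2 - 4 * (z - 1) ^ 2 =
    z * ((z + t - 4) * (z ^ 2 + t * z - 4)) by ring, Real.sqrt_mul hz, ← div_div, Real.div_sqrt]

lemma integral_logMeanQ_sub_eq_integral_logMeanR_sub {a b : ℝ} (ha : 4 ≤ a) (hab : a ≤ b) :
    (∫ θ in Ioc 0 (2 * π), logMeanQ b (2 + 2 * cos θ)) -
        ∫ θ in Ioc 0 (2 * π), logMeanQ a (2 + 2 * cos θ) =
      (∫ θ in Ioc 0 (2 * π), logMeanR b (2 + 2 * cos θ)) -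
        ∫ θ in Ioc 0 (2 * π), logMeanR a (2 + 2 * cos θ) := by
  rw [integral_logMeanQ_sub (by linarith) hab, integral_logMeanR_sub ha hab]
  exact congrArg ENNReal.toReal
    (setLIntegral_congr_fun measurableSet_Ioc fun t ht => lintegral_elliptic_eq (ha.trans ht.1.le))

lemma tendsto_integral_logMeanQ_sub_log :
    Tendsto (fun b => ∫ θ in Ioc 0 (2 * π), (logMeanQ b (2 + 2 * cos θ) - log b)) atTop
      (𝓝 0) := by
  have hsqrt : ∀ θ, log √(2 + 2 * cos θ) = log (2 + 2 * cos θ) / 2 := fun θ =>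
    Real.log_sqrt (by linarith [neg_one_le_cos θ])
  have hlog : IntegrableOn (fun θ => log √(2 + 2 * cos θ)) (Ioc 0 (2 * π)) := by
    simp only [hsqrt]
    exact integrableOn_log_two_add_two_mul_cos.div_const 2
  have hpos : ∀ᵐ θ ∂volume.restrict (Ioc 0 (2 * π)),
      0 < √(2 + 2 * cos θ) ∧ 0 < √(2 + 2 * cos θ) := by
    filter_upwards [ae_two_add_two_mul_cos_pos _] with θ hθ
    exact ⟨Real.sqrt_pos.2 hθ, Real.sqrt_pos.2 hθ⟩
  have h := tendsto_integral_log_maxRootNorm_sub_log (A := fun θ => 2 + 2 * cos θ - 1)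
    (e := fun _ => 0) (Continuous.integrableOn_Ioc (by fun_prop))
    (Continuous.integrableOn_Ioc (by fun_prop)) (integrable_const _) hpos hlog
    (Eventually.of_forall fun b => ae_of_all _ fun θ => le_max_of_le_right ?_)
  · simpa only [logMeanQ, add_zero, hsqrt, integral_div, integral_log_two_add_two_mul_cos,
      zero_div] using h
  · rw [add_zero, mul_comm]
    exact le_abs_self _

lemma mul_div_six_le_max_abs {b z : ℝ} (hb : 8 ≤ b) (hz : 0 ≤ z) :
    b * (z / 6) ≤ max |z - 1| |z * b + (z ^ 2 - 2 * z - 2)| := by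
  have hA := le_max_left |z - 1| |z * b + (z ^ 2 - 2 * z - 2)|
  have hB := le_max_right |z - 1| |z * b + (z ^ 2 - 2 * z - 2)|
  have hdiff : b * (z / 2) ≤ z * b + (z ^ 2 - 2 * z - 2) - 2 * (z - 1) := by
    nlinarith [mul_nonneg hz (sub_nonneg.2 hb), sq_nonneg z]
  linarith [neg_abs_le (z - 1), le_abs_self (z * b + (z ^ 2 - 2 * z - 2))]

lemma tendsto_integral_logMeanR_sub_log :
    Tendsto (fun b => ∫ θ in Ioc 0 (2 * π), (logMeanR b (2 + 2 * cos θ) - log b)) atTop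
      (𝓝 0) := by
  have hpos : ∀ᵐ θ ∂volume.restrict (Ioc 0 (2 * π)),
      0 < 2 + 2 * cos θ ∧ 0 < (2 + 2 * cos θ) / 6 := by
    filter_upwards [ae_two_add_two_mul_cos_pos _] with θ hθ
    exact ⟨hθ, by positivity⟩
  have hlog : IntegrableOn (fun θ => log ((2 + 2 * cos θ) / 6)) (Ioc 0 (2 * π)) := by
    refine (integrableOn_log_two_add_two_mul_cos.sub (integrable_const (log 6))).congr ?_
    filter_upwards [ae_two_add_two_mul_cos_pos _] with θ hθ
    exact (Real.log_div hθ.ne' (by norm_num)).symm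
  have h := tendsto_integral_log_maxRootNorm_sub_log (A := fun θ => 2 + 2 * cos θ - 1)
    (e := fun θ => (2 + 2 * cos θ) ^ 2 - 2 * (2 + 2 * cos θ) - 2)
    (Continuous.integrableOn_Ioc (by fun_prop)) (Continuous.integrableOn_Ioc (by fun_prop))
    (Continuous.integrableOn_Ioc (by fun_prop)) hpos hlog ?_
  · rwa [integral_log_two_add_two_mul_cos] at h
  · filter_upwards [eventually_ge_atTop 8] with b hb
    exact ae_of_all _ fun θ => mul_div_six_le_max_abs hb (by linarith [neg_one_le_cos θ])

theorem integral_logMeanQ_eq_integral_logMeanR {α : ℝ} (hα : 4 ≤ α) :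
    ∫ θ in Ioc 0 (2 * π), logMeanQ α (2 + 2 * cos θ) =
      ∫ θ in Ioc 0 (2 * π), logMeanR α (2 + 2 * cos θ) := by
  have h := tendsto_integral_logMeanQ_sub_log.sub tendsto_integral_logMeanR_sub_log
  rw [sub_zero] at h
  refine sub_eq_zero.1 (tendsto_nhds_unique (tendsto_const_nhds.congr' ?_) h)
  filter_upwards [eventually_ge_atTop α] with b hb
  rw [integral_sub (integrableOn_logMeanQ b) (integrable_const _),
    integral_sub (integrableOn_logMeanR b) (integrable_const _)]
  linarith [integral_logMeanQ_sub_eq_integral_logMeanR_sub hα hb]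

/-! ### Mahler measures -/

lemma measurePreserving_finTwoArrow_restrict :
    MeasurePreserving (MeasurableEquiv.finTwoArrow (α := ℝ))
      (volume.restrict (Icc 0 fun _ => 2 * π))
      ((volume.restrict (Ioc 0 (2 * π))).prod (volume.restrict (Ioc 0 (2 * π)))) := by
  have hpre : MeasurableEquiv.finTwoArrow ⁻¹' (Icc 0 (2 * π) ×ˢ Icc 0 (2 * π)) =
      Icc (0 : Fin 2 → ℝ) fun _ => 2 * π := by
    ext θ
    simp only [mem_Icc, Pi.le_def, Fin.forall_fin_two, mem_preimage, mem_prod,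
      MeasurableEquiv.finTwoArrow_apply, Pi.zero_apply]
    tauto
  rw [restrict_Ioc_eq_restrict_Icc, Measure.prod_restrict, ← Measure.volume_eq_prod, ← hpre]
  exact (volume_preserving_finTwoArrow ℝ).restrict_preimage
    (measurableSet_Icc.prod measurableSet_Icc)

lemma integral_Ioc_log_abs_two_mul_cos_sub_add (A B s : ℝ) :
    ∫ φ in Ioc 0 (2 * π), log |2 * A * cos (φ - s) + B| = 2 * π * log (maxRootNorm A B) := by
  rw [← intervalIntegral.integral_of_le two_pi_pos.le, integral_log_abs_two_mul_cos_sub_add]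

lemma integrable_prod_log_abs_two_mul_cos_sub_add {A B s : ℝ → ℝ} (hA : Continuous A)
    (hB : Continuous B) (hs : Continuous s)
    (hint : IntegrableOn (fun θ => log (maxRootNorm (A θ) (B θ))) (Ioc 0 (2 * π))) :
    Integrable (fun p : ℝ × ℝ => log |2 * A p.1 * cos (p.2 - s p.1) + B p.1|)
      ((volume.restrict (Ioc 0 (2 * π))).prod (volume.restrict (Ioc 0 (2 * π)))) := by
  have hmeas : Measurable fun p : ℝ × ℝ => log |2 * A p.1 * cos (p.2 - s p.1) + B p.1| :=
    Real.measurable_log.comp (by fun_prop : Continuous _).measurable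
  have hbound : IntegrableOn (fun θ => 2 * |A θ| + |B θ|) (Ioc 0 (2 * π)) :=
    Continuous.integrableOn_Ioc (by fun_prop)
  refine integrable_prod_of_le hmeas.aestronglyMeasurable (hbound.comp_fst _) (fun p => ?_)
    (ae_of_all _ fun θ => ?_) ?_
  · have hcos : |2 * A p.1 * cos (p.2 - s p.1)| ≤ 2 * |A p.1| := by
      rw [abs_mul, abs_mul, abs_two]
      exact mul_le_of_le_one_right (by positivity) (abs_cos_le_one _)
    exact (Real.log_le_self (abs_nonneg _)).trans ((abs_add_le _ _).trans (by gcongr))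
  · exact (intervalIntegrable_iff_integrableOn_Ioc_of_le two_pi_pos.le).1
      (intervalIntegrable_log_abs_two_mul_cos_sub_add (A θ) (B θ) (s θ) 0 (2 * π))
  · simpa only [integral_Ioc_log_abs_two_mul_cos_sub_add] using hint.const_mul (2 * π)

theorem mahlerIntegrable_of_norm_eval_eq {P : MvPolynomial (Fin 2) ℂ} {A B s : ℝ → ℝ}
    (hA : Continuous A) (hB : Continuous B) (hs : Continuous s)
    (hP : ∀ θ : Fin 2 → ℝ, ‖MvPolynomial.eval (torusMap 0 1 θ) P‖ =
      |2 * A (θ 0) * cos (θ 1 - s (θ 0)) + B (θ 0)|)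
    (hint : IntegrableOn (fun θ => log (maxRootNorm (A θ) (B θ))) (Ioc 0 (2 * π))) :
    MahlerIntegrable P := by
  have hprod := integrable_prod_log_abs_two_mul_cos_sub_add hA hB hs hint
  rw [← measurePreserving_finTwoArrow_restrict.integrable_comp_emb
    MeasurableEquiv.finTwoArrow.measurableEmbedding] at hprod
  exact hprod.congr (ae_of_all _ fun θ => (congrArg log (hP θ)).symm)

theorem mahlerMeasureLog_of_norm_eval_eq {P : MvPolynomial (Fin 2) ℂ} {A B s : ℝ → ℝ}
    (hA : Continuous A) (hB : Continuous B) (hs : Continuous s)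
    (hP : ∀ θ : Fin 2 → ℝ, ‖MvPolynomial.eval (torusMap 0 1 θ) P‖ =
      |2 * A (θ 0) * cos (θ 1 - s (θ 0)) + B (θ 0)|)
    (hint : IntegrableOn (fun θ => log (maxRootNorm (A θ) (B θ))) (Ioc 0 (2 * π))) :
    mahlerMeasureLog P = (2 * π)⁻¹ * ∫ θ in Ioc 0 (2 * π), log (maxRootNorm (A θ) (B θ)) := by
  have hprod := integrable_prod_log_abs_two_mul_cos_sub_add hA hB hs hint
  have hmean : ∫ θ in Icc (0 : Fin 2 → ℝ) fun _ => 2 * π,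
      log ‖MvPolynomial.eval (torusMap 0 1 θ) P‖ =
      2 * π * ∫ θ in Ioc 0 (2 * π), log (maxRootNorm (A θ) (B θ)) := by
    simp only [hP]
    refine (measurePreserving_finTwoArrow_restrict.integral_comp' (g := fun p : ℝ × ℝ =>
      log |2 * A p.1 * cos (p.2 - s p.1) + B p.1|)).trans ?_
    rw [integral_prod _ hprod]
    simp only [integral_Ioc_log_abs_two_mul_cos_sub_add, integral_const_mul]
  rw [mahlerMeasureLog, hmean, zpow_neg, zpow_natCast]
  field_simp

lemma torusMap_zero_one_apply {n : ℕ} (θ : Fin n → ℝ) (i : Fin n) :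
    torusMap 0 1 θ i = Complex.exp (θ i * Complex.I) := by
  simp [torusMap]

lemma norm_eval_polyQ (α : ℝ) (θ : Fin 2 → ℝ) :
    ‖MvPolynomial.eval (torusMap 0 1 θ) (polyQ α)‖ =
      |2 * (2 + 2 * cos (θ 0) - 1) * cos (θ 1 - θ 0 / 2) + 2 * cos (θ 0 / 2) * α| := by
  have hfactor : MvPolynomial.eval (torusMap 0 1 θ) (polyQ α) =
      Complex.exp ((3 * (θ 0 / 2) + θ 1 : ℝ) * Complex.I) *
      ((2 * (2 + 2 * cos (θ 0) - 1) * cos (θ 1 - θ 0 / 2) + 2 * cos (θ 0 / 2) * α : ℝ) : ℂ) := by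
    obtain ⟨t, ht⟩ : ∃ t, θ 0 = 2 * t := ⟨θ 0 / 2, by ring⟩
    simp only [polyQ, map_add, map_mul, map_pow, MvPolynomial.eval_X, MvPolynomial.eval_C,
      map_one, torusMap_zero_one_apply, ht]
    rw [mul_div_cancel_left₀ _ (two_ne_zero' ℝ)]
    push_cast
    simp only [Complex.cos, mul_sub, sub_mul, add_mul, neg_mul, neg_sub, Complex.exp_add,
      Complex.exp_sub, Complex.exp_neg]
    rw [show (2 : ℂ) * t * Complex.I = (2 : ℕ) * (t * Complex.I) by push_cast; ring,
      show (3 : ℂ) * t * Complex.I = (3 : ℕ) * (t * Complex.I) by push_cast; ring,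
      Complex.exp_nat_mul, Complex.exp_nat_mul]
    have hx := Complex.exp_ne_zero (t * Complex.I)
    have hy := Complex.exp_ne_zero (θ 1 * Complex.I)
    generalize Complex.exp (t * Complex.I) = x at hx ⊢
    generalize Complex.exp (θ 1 * Complex.I) = y at hy ⊢
    field_simp
    ring
  rw [hfactor, norm_mul, Complex.norm_exp_ofReal_mul_I, one_mul, Complex.norm_real,
    Real.norm_eq_abs]

lemma norm_eval_polyR (α : ℝ) (θ : Fin 2 → ℝ) :
    ‖MvPolynomial.eval (torusMap 0 1 θ) (polyR (α + 2))‖ =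
      |2 * (2 + 2 * cos (θ 0) - 1) * cos (θ 1 - θ 0) +
        ((2 + 2 * cos (θ 0)) * α + ((2 + 2 * cos (θ 0)) ^ 2 - 2 * (2 + 2 * cos (θ 0)) - 2))| := by
  have hfactor : MvPolynomial.eval (torusMap 0 1 θ) (polyR (α + 2)) =
      Complex.exp ((2 * θ 0 + θ 1 : ℝ) * Complex.I) *
      ((2 * (2 + 2 * cos (θ 0) - 1) * cos (θ 1 - θ 0) + ((2 + 2 * cos (θ 0)) * α +
        ((2 + 2 * cos (θ 0)) ^ 2 - 2 * (2 + 2 * cos (θ 0)) - 2)) : ℝ) : ℂ) := by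
    simp only [polyR, map_add, map_mul, map_sub, map_pow, MvPolynomial.eval_X, MvPolynomial.eval_C,
      map_one, torusMap_zero_one_apply, map_ofNat]
    push_cast
    simp only [Complex.cos, mul_sub, sub_mul, add_mul, neg_mul, neg_sub, Complex.exp_add,
      Complex.exp_sub, Complex.exp_neg]
    rw [show (2 : ℂ) * θ 0 * Complex.I = (2 : ℕ) * (θ 0 * Complex.I) by push_cast; ring,
      Complex.exp_nat_mul]
    have hx := Complex.exp_ne_zero (θ 0 * Complex.I)
    have hy := Complex.exp_ne_zero (θ 1 * Complex.I)
    generalize Complex.exp (θ 0 * Complex.I) = x at hx ⊢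
    generalize Complex.exp (θ 1 * Complex.I) = y at hy ⊢
    field_simp
    ring
  rw [hfactor, norm_mul, Complex.norm_exp_ofReal_mul_I, one_mul, Complex.norm_real,
    Real.norm_eq_abs]

lemma log_maxRootNorm_two_mul_cos_half (α θ : ℝ) :
    log (maxRootNorm (2 + 2 * cos θ - 1) (2 * cos (θ / 2) * α)) = logMeanQ α (2 + 2 * cos θ) := by
  have hsq : 2 + 2 * cos θ = (2 * cos (θ / 2)) ^ 2 := by rw [mul_pow, cos_sq]; ring_nf
  rw [logMeanQ, ← maxRootNorm_abs_right _ (√_ * α), abs_mul, hsq, Real.sqrt_sq_eq_abs, abs_abs,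
    ← abs_mul, maxRootNorm_abs_right]

theorem mahlerIntegrable_polyQ (α : ℝ) : MahlerIntegrable (polyQ α) :=
  mahlerIntegrable_of_norm_eval_eq (A := fun θ => 2 + 2 * cos θ - 1)
    (B := fun θ => 2 * cos (θ / 2) * α) (s := fun θ => θ / 2) (by fun_prop) (by fun_prop)
    (by fun_prop) (norm_eval_polyQ α) (integrableOn_log_maxRootNorm (by fun_prop))

theorem mahlerIntegrable_polyR (α : ℝ) : MahlerIntegrable (polyR (α + 2)) :=
  mahlerIntegrable_of_norm_eval_eq (by fun_prop) (by fun_prop) continuous_id (norm_eval_polyR α)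
    (integrableOn_logMeanR α)

theorem mahlerMeasureLog_polyQ (α : ℝ) :
    mahlerMeasureLog (polyQ α) =
      (2 * π)⁻¹ * ∫ θ in Ioc 0 (2 * π), logMeanQ α (2 + 2 * cos θ) := by
  simpa only [log_maxRootNorm_two_mul_cos_half] using
    mahlerMeasureLog_of_norm_eval_eq (A := fun θ => 2 + 2 * cos θ - 1)
      (B := fun θ => 2 * cos (θ / 2) * α) (s := fun θ => θ / 2) (by fun_prop) (by fun_prop)
      (by fun_prop) (norm_eval_polyQ α) (integrableOn_log_maxRootNorm (by fun_prop))

theorem mahlerMeasureLog_polyR (α : ℝ) :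
    mahlerMeasureLog (polyR (α + 2)) =
      (2 * π)⁻¹ * ∫ θ in Ioc 0 (2 * π), logMeanR α (2 + 2 * cos θ) :=
  mahlerMeasureLog_of_norm_eval_eq (by fun_prop) (by fun_prop) continuous_id (norm_eval_polyR α)
    (integrableOn_logMeanR α)

end

theorem theorem1p2 (α : ℝ) (hα : 4 ≤ α) :
    MahlerIntegrable (polyQ α) ∧ MahlerIntegrable (polyR (α + 2)) ∧
      mahlerMeasureLog (polyQ α) = mahlerMeasureLog (polyR (α + 2)) := by
  refine ⟨mahlerIntegrable_polyQ α, mahlerIntegrable_polyR α, ?_⟩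
  rw [mahlerMeasureLog_polyQ, mahlerMeasureLog_polyR, integral_logMeanQ_eq_integral_logMeanR hα]
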